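/- Let $(\cdot,\cdot)$ be the inner product of $L_2(\mathbb R)$ (complex-valued functions, linear in the second argument), let $q_1,q_2\in L_2(\mathbb R)$, and let $W_2^2(\mathbb R\setminus\{0\})$ be the space of all $f\in L_2(\mathbb R)$ whose weak derivatives $f',f''$ on $\mathbb R\setminus\{0\}$ exist and belong to $L_2(\mathbb R)$. For such $f$ the one-sided limits $f(0\pm)$ and $f'(0\pm)$ exist; put $$f_r(0)=\tfrac{f(0+)+f(0-)}2,\quad f_r'(0)=\tfrac{f'(0+)+f'(0-)}2,\quad f_s(0)=f(0+)-f(0-),\quad f_s'(0)=f'(0+)-f'(0-),$$ $$\Gamma_0f=\begin{pmatrix} f_r(0)\\ -f_r'(0)\end{pmatrix},\qquad \Gamma_1f=\begin{pmatrix} f_s'(0)-(q_1,f)\\ f_s(0)-(q_2,f)\end{pmatrix}.$$ For a complex matrix $\mathbf T=\begin{pmatrix} a&b\\ c&d\end{pmatrix}$ let $H_{\mathbf T}$ be the operator in $L_2(\mathbb R)$ given by $$H_{\mathbf T}f=-f''+f_r(0)\,q_1-f_r'(0)\,q_2,\qquad \mathcal D(H_{\mathbf T})=\{f\in W_2^2(\mathbb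 R\setminus\{0\}) : \mathbf T\Gamma_0f=\Gamma_1f\},$$ where $f''$ is the weak second derivative on $\mathbb R\setminus\{0\}$. **Lemma 3.1.** If $a,d\in\mathbb R$ and $b=\overline{c}$, then $H_{\mathbf T}$ is self-adjoint in $L_2(\mathbb R)$ for any choice of $q_1,q_2\in L_2(\mathbb R)$. -/

import Mathlib

open MeasureTheory Filter Topology Set
open scoped ContDiff

noncomputable section

namespace NonlocalPoint

/-- The complex Hilbert space of square integrable functions on the line; its inner product is
linear in the second argument. -/
abbrev L2 : Type := Lp ℂ 2 (volume : Measure ℝ)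

/-- `g` is the weak derivative of `f` on the open set of nonzero reals. -/
def HasWeakDeriv (f g : L2) : Prop :=
  ∀ φ : ℝ → ℝ, ContDiff ℝ ∞ φ → HasCompactSupport φ → tsupport φ ⊆ {0}ᶜ →
    ∫ x, deriv φ x • f x = -∫ x, φ x • g x

open Classical in
/-- The weak derivative of `f` away from the origin (zero if there is none in `L2`). -/
def weakDeriv (f : L2) : L2 := if h : ∃ g, HasWeakDeriv f g then h.choose else 0

/-- The one-sided boundary value `f(0+)`: the limit of `f(x)` as `x > 0` tends to `0` outside of a
null set.  It does not depend on the representative of the class of `f`, and it is the usual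
limit at `0` from the right of a representative that is continuous on the positive half-line. -/
def traceRight (f : L2) : ℂ := limUnder (𝓝[>] (0 : ℝ) ⊓ ae volume) f

/-- The one-sided boundary value `f(0-)`. -/
def traceLeft (f : L2) : ℂ := limUnder (𝓝[<] (0 : ℝ) ⊓ ae volume) f

/-! ### Helper facts: uniqueness of weak derivatives, existence of traces -/

lemma intervalIntegrable_coe (f : L2) (a b : ℝ) : IntervalIntegrable f volume a b :=
  (((Lp.memLp f).locallyIntegrable (by norm_num)).integrableOn_isCompact
    isCompact_uIcc).intervalIntegrable

lemma integrable_test (f : L2) {φ : ℝ → ℝ} (hφ : Continuous φ) (hc : HasCompactSupport φ) :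
    Integrable (fun x => φ x • f x) :=
  ((Lp.memLp f).locallyIntegrable (by norm_num)).integrable_smul_left_of_hasCompactSupport hφ hc

lemma HasWeakDeriv.add {f g f' g' : L2} (h : HasWeakDeriv f g) (h' : HasWeakDeriv f' g') :
    HasWeakDeriv (f + f') (g + g') := by
  intro φ hφ hc hs
  have hd : Continuous (deriv φ) := hφ.continuous_deriv (by simp)
  have e1 : ∫ x, deriv φ x • (f + f' : L2) x = ∫ x, (deriv φ x • f x + deriv φ x • f' x) := by
    refine integral_congr_ae ?_
    filter_upwards [Lp.coeFn_add f f'] with x hx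
    rw [hx, Pi.add_apply, smul_add]
  have e2 : ∫ x, φ x • (g + g' : L2) x = ∫ x, (φ x • g x + φ x • g' x) := by
    refine integral_congr_ae ?_
    filter_upwards [Lp.coeFn_add g g'] with x hx
    rw [hx, Pi.add_apply, smul_add]
  rw [e1, e2, integral_add (integrable_test f hd hc.deriv) (integrable_test f' hd hc.deriv),
    integral_add (integrable_test g hφ.continuous hc) (integrable_test g' hφ.continuous hc),
    h φ hφ hc hs, h' φ hφ hc hs, neg_add]

lemma HasWeakDeriv.smul {f g : L2} (c : ℂ) (h : HasWeakDeriv f g) :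
    HasWeakDeriv (c • f) (c • g) := by
  intro φ hφ hc hs
  have e1 : ∫ x, deriv φ x • (c • f : L2) x = ∫ x, c • (deriv φ x • f x) := by
    refine integral_congr_ae ?_
    filter_upwards [Lp.coeFn_smul c f] with x hx
    rw [hx, Pi.smul_apply, smul_comm]
  have e2 : ∫ x, φ x • (c • g : L2) x = ∫ x, c • (φ x • g x) := by
    refine integral_congr_ae ?_
    filter_upwards [Lp.coeFn_smul c g] with x hx
    rw [hx, Pi.smul_apply, smul_comm]
  rw [e1, e2, integral_smul, integral_smul, h φ hφ hc hs, smul_neg]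

lemma HasWeakDeriv.zero : HasWeakDeriv 0 0 := by
  intro φ _ _ _
  have e (ψ : ℝ → ℝ) : ∫ x, ψ x • (0 : L2) x = 0 := by
    rw [← integral_zero ℝ ℂ (μ := volume)]
    refine integral_congr_ae ?_
    filter_upwards [Lp.coeFn_zero ℂ 2 (volume : Measure ℝ)] with x hx
    rw [hx, Pi.zero_apply, smul_zero]
  rw [e, e, neg_zero]

lemma HasWeakDeriv.unique {f g g' : L2} (h : HasWeakDeriv f g) (h' : HasWeakDeriv f g') :
    g = g' := by
  have h0 := h.add (h'.smul (-1))
  have hz : f + (-1 : ℂ) • f = 0 := by simp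
  rw [hz] at h0
  have key : ∀ᵐ x, x ∈ ({0}ᶜ : Set ℝ) → (g + (-1 : ℂ) • g' : L2) x = 0 := by
    refine isOpen_compl_singleton.ae_eq_zero_of_integral_contDiff_smul_eq_zero
      (((Lp.memLp _).locallyIntegrable (by norm_num)).locallyIntegrableOn _) ?_
    intro φ hφ hc hs
    have := h0 φ hφ hc hs
    have e : ∫ x, deriv φ x • (0 : L2) x = 0 := by
      rw [← integral_zero ℝ ℂ (μ := volume)]
      refine integral_congr_ae ?_
      filter_upwards [Lp.coeFn_zero ℂ 2 (volume : Measure ℝ)] with x hx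
      rw [hx, Pi.zero_apply, smul_zero]
    rw [e] at this
    exact neg_eq_zero.mp this.symm
  have hall : (g + (-1 : ℂ) • g' : L2) = 0 := by
    rw [Lp.eq_zero_iff_ae_eq_zero]
    filter_upwards [key, Measure.ae_ne volume 0] with x hx h0
    exact hx h0
  have : g - g' = 0 := by rw [← hall]; simp [sub_eq_add_neg]
  exact sub_eq_zero.mp this

lemma HasWeakDeriv.weakDeriv_eq {f g : L2} (h : HasWeakDeriv f g) : weakDeriv f = g := by
  have hex : ∃ g, HasWeakDeriv f g := ⟨g, h⟩
  rw [weakDeriv, dif_pos hex]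
  exact hex.choose_spec.unique h

/-- Integration by parts of a test function against an indefinite integral. -/
lemma integral_parts {α β : ℝ} (hαβ : α ≤ β) {φ : ℝ → ℝ} (hφ : ContDiff ℝ ∞ φ)
    (h2 : φ β = 0) (g : ℝ → ℂ) (hg : IntervalIntegrable g volume α β) :
    ∫ x in α..β, deriv φ x • (∫ t in α..x, g t) = -∫ x in α..β, φ x • g x := by
  have hd : Continuous (deriv φ) := hφ.continuous_deriv (by simp)
  have hg' : Integrable g (volume.restrict (Ioc α β)) := hg.1
  have hdi : Integrable (deriv φ) (volume.restrict (Ioc α β)) :=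
    (hd.intervalIntegrable α β).1
  set F : ℝ → ℝ → ℂ := fun x t => if t ≤ x then deriv φ x • g t else 0 with hF
  have hint : Integrable (Function.uncurry F)
      ((volume.restrict (Ioc α β)).prod (volume.restrict (Ioc α β))) := by
    have h := (hdi.smul_prod hg').indicator
      (measurableSet_le measurable_snd measurable_fst : MeasurableSet {p : ℝ × ℝ | p.2 ≤ p.1})
    refine h.congr (Eventually.of_forall fun p => ?_)
    simp only [hF, Function.uncurry, indicator, mem_ofPred_eq]
  have hswap := integral_integral_swap hint
  rw [intervalIntegral.integral_of_le hαβ, intervalIntegral.integral_of_le hαβ]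
  have e1 : ∫ x in Ioc α β, deriv φ x • (∫ t in α..x, g t) =
      ∫ x in Ioc α β, ∫ t in Ioc α β, F x t := by
    refine setIntegral_congr_fun measurableSet_Ioc fun x hx => ?_
    have hset : Ioc α β ∩ Iic x = Ioc α x := by
      ext t
      simp only [mem_inter_iff, mem_Ioc, mem_Iic]
      exact ⟨fun h => ⟨h.1.1, h.2⟩, fun h => ⟨⟨h.1, h.2.trans hx.2⟩, h.2⟩⟩
    have : F x = indicator (Iic x) (fun t => deriv φ x • g t) := by
      ext t
      simp only [hF, indicator, mem_Iic]
    simp only [this]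
    rw [setIntegral_indicator measurableSet_Iic, hset, integral_smul,
      intervalIntegral.integral_of_le hx.1.le]
  have e2 : ∫ t in Ioc α β, ∫ x in Ioc α β, F x t = ∫ t in Ioc α β, -(φ t • g t) := by
    refine setIntegral_congr_fun measurableSet_Ioc fun t ht => ?_
    have hset : Ioc α β ∩ Ici t = Icc t β := by
      ext x
      simp only [mem_inter_iff, mem_Ioc, mem_Ici, mem_Icc]
      exact ⟨fun h => ⟨h.2, h.1.2⟩, fun h => ⟨⟨ht.1.trans_le h.1, h.2⟩, h.1⟩⟩
    have : (fun x => F x t) = indicator (Ici t) (fun x => deriv φ x • g t) := by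
      ext x
      simp only [hF, indicator, mem_Ici]
    simp only [this]
    rw [setIntegral_indicator measurableSet_Ici, hset, integral_smul_const,
      integral_Icc_eq_integral_Ioc, ← intervalIntegral.integral_of_le ht.2,
      intervalIntegral.integral_deriv_eq_sub
        (fun x _ => (hφ.differentiable (by simp)).differentiableAt)
        (hd.intervalIntegrable _ _), h2, zero_sub, neg_smul]
  rw [e1, hswap, e2, integral_neg]

lemma ae_eq_primitive (f g : L2) {α β : ℝ} (hαβ : α < β) (h0 : (0 : ℝ) ∉ Ioo α β)
    (h : HasWeakDeriv f g) :
    ∃ C : ℂ, ∀ᵐ x, x ∈ Ioo α β → f x = C + ∫ t in α..x, g t := by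
  set G : ℝ → ℂ := fun x => ∫ t in α..x, g t with hG
  have hGc : Continuous G :=
    intervalIntegral.continuous_primitive (fun a b => intervalIntegrable_coe g a b) α
  set F : ℝ → ℂ := fun x => f x - G x with hF
  have hFl : LocallyIntegrable F :=
    ((Lp.memLp f).locallyIntegrable (by norm_num)).sub hGc.locallyIntegrable
  have hFi {φ : ℝ → ℝ} (hφ : Continuous φ) (hc : HasCompactSupport φ) :
      Integrable (fun x => φ x • F x) :=
    hFl.integrable_smul_left_of_hasCompactSupport hφ hc
  have hvan {φ : ℝ → ℝ} (hs : tsupport φ ⊆ Ioo α β) {x : ℝ} (hx : x ∉ Ioo α β) : φ x = 0 :=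
    image_eq_zero_of_notMem_tsupport fun h => hx (hs h)
  have hwhole {u : ℝ → ℂ} (hu : ∀ x, x ∉ Ioo α β → u x = 0) : ∫ x, u x = ∫ x in α..β, u x := by
    rw [intervalIntegral.integral_of_le hαβ.le]
    exact (setIntegral_eq_integral_of_forall_compl_eq_zero
      fun x hx => hu x fun h => hx (Ioo_subset_Ioc_self h)).symm
  have hA {φ : ℝ → ℝ} (hφ : ContDiff ℝ ∞ φ) (hc : HasCompactSupport φ)
      (hs : tsupport φ ⊆ Ioo α β) : ∫ x, deriv φ x • F x = 0 := by
    have hd : Continuous (deriv φ) := hφ.continuous_deriv (by simp)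
    have hs' : tsupport (deriv φ) ⊆ Ioo α β :=
      (closure_minimal (support_deriv_subset) (isClosed_tsupport φ)).trans hs
    have e1 := h φ hφ hc fun x hx hx0 => h0 (by
      rw [mem_singleton_iff] at hx0
      exact hx0 ▸ hs hx)
    have e2 := integral_parts hαβ.le hφ (hvan hs (by simp)) g
      (intervalIntegrable_coe g α β)
    have e3 : ∫ x, deriv φ x • G x = ∫ x in α..β, deriv φ x • G x :=
      hwhole fun x hx => by rw [hvan hs' hx, zero_smul]
    have e4 : ∫ x, φ x • g x = ∫ x in α..β, φ x • g x :=
      hwhole fun x hx => by rw [hvan hs hx, zero_smul]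
    have hGi : Integrable (fun x => deriv φ x • G x) :=
      hGc.locallyIntegrable.integrable_smul_left_of_hasCompactSupport hd hc.deriv
    simp only [hF, smul_sub]
    rw [integral_sub (integrable_test f hd hc.deriv) hGi, e1, e3, e2, e4, sub_self]
  let m : ℝ := (α + β) / 2
  let bump : ContDiffBump m := ⟨(β - α) / 8, (β - α) / 4, by linarith, by linarith⟩
  set χ : ℝ → ℝ := bump.normed volume with hχ
  have hχs : ContDiff ℝ ∞ χ := bump.contDiff_normed
  have hχc : HasCompactSupport χ := bump.hasCompactSupport_normed
  have hχ1 : ∫ x, χ x = 1 := bump.integral_normed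
  have hχt : tsupport χ ⊆ Ioo α β := by
    rw [hχ, bump.tsupport_normed_eq, Real.closedBall_eq_Icc]
    intro x hx
    simp only [mem_Icc, m, bump] at hx
    constructor <;> linarith [hx.1, hx.2]
  set C : ℂ := ∫ x, χ x • F x with hC
  have hB : ∀ ψ : ℝ → ℝ, ContDiff ℝ ∞ ψ → HasCompactSupport ψ → tsupport ψ ⊆ Ioo α β →
      ∫ x, ψ x • (F x - C) = 0 := by
    intro ψ hψ hψc hψs
    set κ : ℝ := ∫ x, ψ x with hκ
    set ρ : ℝ → ℝ := fun x => ψ x - κ * χ x with hρ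
    have hρd : ContDiff ℝ ∞ ρ := hψ.sub (contDiff_const.mul hχs)
    have hψi : Integrable ψ := hψ.continuous.integrable_of_hasCompactSupport hψc
    have hχi : Integrable χ := hχs.continuous.integrable_of_hasCompactSupport hχc
    have hρi : Integrable ρ := hψi.sub (hχi.const_mul κ)
    have hρ0 : ∫ x, ρ x = 0 := by
      simp only [hρ]
      rw [integral_sub hψi (hχi.const_mul κ), integral_const_mul, hχ1, mul_one, sub_self]
    let K : Set ℝ := tsupport ψ ∪ tsupport χ ∪ {m}
    have hK : IsCompact K := (hψc.isCompact.union hχc.isCompact).union isCompact_singleton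
    have hKn : K.Nonempty := ⟨m, Or.inr rfl⟩
    have hKs : K ⊆ Ioo α β := by
      refine union_subset (union_subset hψs hχt) (singleton_subset_iff.mpr ?_)
      constructor <;> simp only [m] <;> linarith
    obtain ⟨a, haK, ha⟩ := hK.exists_isLeast hKn
    obtain ⟨b, hbK, hb⟩ := hK.exists_isGreatest hKn
    have hρK {x : ℝ} (hx : x ∉ K) : ρ x = 0 := by
      have h1 : ψ x = 0 := image_eq_zero_of_notMem_tsupport fun h => hx (Or.inl (Or.inl h))
      have h2 : χ x = 0 := image_eq_zero_of_notMem_tsupport fun h => hx (Or.inl (Or.inr h))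
      simp only [hρ, h1, h2, mul_zero, sub_zero]
    have hρa {x : ℝ} (hx : x < a) : ρ x = 0 := hρK fun h => (not_lt.mpr (ha h)) hx
    have hρb {x : ℝ} (hx : b < x) : ρ x = 0 := hρK fun h => (not_lt.mpr (hb h)) hx
    set φ : ℝ → ℝ := fun x => ∫ t in Iic x, ρ t with hφ
    have hφi (x : ℝ) : φ x = φ a + ∫ t in a..x, ρ t := by
      rw [← intervalIntegral.integral_Iic_sub_Iic hρi.integrableOn hρi.integrableOn]
      simp only [hφ, add_sub_cancel]
    have hφd (x : ℝ) : HasDerivAt φ (ρ x) x := by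
      have : φ = fun x => φ a + ∫ t in a..x, ρ t := funext hφi
      rw [this]
      exact (intervalIntegral.integral_hasDerivAt_right (hρd.continuous.intervalIntegrable _ _)
        hρd.continuous.stronglyMeasurable.stronglyMeasurableAtFilter
        hρd.continuous.continuousAt).const_add _
    have hφ' : deriv φ = ρ := funext fun x => (hφd x).deriv
    have hφs : ContDiff ℝ ∞ φ := by
      rw [contDiff_infty_iff_deriv, hφ']
      exact ⟨fun x => (hφd x).differentiableAt, hρd⟩
    have hφab : Function.support φ ⊆ Icc a b := by
      intro x hx
      by_contra hn
      apply hx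
      rcases lt_or_ge x a with hxa | hxa
      · exact setIntegral_eq_zero_of_forall_eq_zero fun t ht => hρa (lt_of_le_of_lt ht hxa)
      · have hbx : b < x := by
          by_contra hbx
          exact hn ⟨hxa, not_lt.mp hbx⟩
        rw [hφ, ← hρ0]
        exact setIntegral_eq_integral_of_forall_compl_eq_zero fun t ht =>
          hρb (hbx.trans (not_le.mp ht))
    have hts : tsupport φ ⊆ Icc a b := closure_minimal hφab isClosed_Icc
    have hφc : HasCompactSupport φ := isCompact_Icc.of_isClosed_subset (isClosed_tsupport φ) hts
    have key := hA hφs hφc (hts.trans (Icc_subset_Ioo (hKs haK).1 (hKs hbK).2))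
    have e1 : ∫ x, deriv φ x • F x = ∫ x, (ψ x • F x - κ • (χ x • F x)) := by
      refine integral_congr_ae (Eventually.of_forall fun x => ?_)
      simp only [hφ', hρ, sub_smul, mul_smul]
    have hψF := hFi hψ.continuous hψc
    have hχF := hFi hχs.continuous hχc
    rw [e1, integral_sub hψF (hχF.fun_smul κ), integral_smul, ← hC] at key
    simp only [smul_sub]
    rw [integral_sub hψF (hψi.smul_const C), integral_smul_const, ← hκ, key]
  have hfin := isOpen_Ioo.ae_eq_zero_of_integral_contDiff_smul_eq_zero
    ((hFl.sub (locallyIntegrable_const C)).locallyIntegrableOn (Ioo α β)) hB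
  refine ⟨C, ?_⟩
  filter_upwards [hfin] with x hx hxI
  have := hx hxI
  simp only [Pi.sub_apply, hF] at this
  linear_combination this

instance neBot_right : (𝓝[>] (0 : ℝ) ⊓ ae volume).NeBot := by
  refine inf_neBot_iff.mpr fun s hs t ht => ?_
  obtain ⟨u, hu, hus⟩ := mem_nhdsGT_iff_exists_Ioo_subset.mp hs
  have hpos : volume (Ioo 0 u) ≠ 0 := by
    rw [Real.volume_Ioo]
    simpa using hu
  by_contra hne
  refine hpos (measure_mono_null (fun x hx hxt => hne ⟨x, hus hx, hxt⟩) (mem_ae_iff.mp ht))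

instance neBot_left : (𝓝[<] (0 : ℝ) ⊓ ae volume).NeBot := by
  refine inf_neBot_iff.mpr fun s hs t ht => ?_
  obtain ⟨u, hu, hus⟩ := mem_nhdsLT_iff_exists_Ioo_subset.mp hs
  have hpos : volume (Ioo u 0) ≠ 0 := by
    rw [Real.volume_Ioo]
    simpa using hu
  by_contra hne
  refine hpos (measure_mono_null (fun x hx hxt => hne ⟨x, hus hx, hxt⟩) (mem_ae_iff.mp ht))

lemma HasWeakDeriv.tendsto_right {f g : L2} (h : HasWeakDeriv f g) :
    Tendsto f (𝓝[>] (0 : ℝ) ⊓ ae volume) (𝓝 (traceRight f)) := by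
  obtain ⟨C, hC⟩ := ae_eq_primitive f g (α := 0) (β := 1) (by norm_num) (by simp) h
  have hc : Continuous fun x => C + ∫ t in 0..x, g t := continuous_const.add
    (intervalIntegral.continuous_primitive (fun a b => intervalIntegrable_coe g a b) _)
  refine tendsto_nhds_limUnder ⟨C + ∫ t in 0..0, g t, ?_⟩
  refine ((hc.tendsto 0).mono_left (inf_le_left.trans nhdsWithin_le_nhds)).congr' ?_
  have hI : ∀ᶠ x in 𝓝[>] (0 : ℝ), x ∈ Ioo (0 : ℝ) 1 := Ioo_mem_nhdsGT (by norm_num)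
  filter_upwards [hI.filter_mono inf_le_left, hC.filter_mono inf_le_right] with x h1 h2
  exact (h2 h1).symm

lemma HasWeakDeriv.tendsto_left {f g : L2} (h : HasWeakDeriv f g) :
    Tendsto f (𝓝[<] (0 : ℝ) ⊓ ae volume) (𝓝 (traceLeft f)) := by
  obtain ⟨C, hC⟩ := ae_eq_primitive f g (α := (-1)) (β := 0) (by norm_num) (by simp) h
  have hc : Continuous fun x => C + ∫ t in (-1)..x, g t := continuous_const.add
    (intervalIntegral.continuous_primitive (fun a b => intervalIntegrable_coe g a b) _)
  refine tendsto_nhds_limUnder ⟨C + ∫ t in (-1)..0, g t, ?_⟩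
  refine ((hc.tendsto 0).mono_left (inf_le_left.trans nhdsWithin_le_nhds)).congr' ?_
  have hI : ∀ᶠ x in 𝓝[<] (0 : ℝ), x ∈ Ioo (-1 : ℝ) 0 := Ioo_mem_nhdsLT (by norm_num)
  filter_upwards [hI.filter_mono inf_le_left, hC.filter_mono inf_le_right] with x h1 h2
  exact (h2 h1).symm

lemma HasWeakDeriv.traceRight_add {f g f' g' : L2} (h : HasWeakDeriv f g)
    (h' : HasWeakDeriv f' g') : traceRight (f + f') = traceRight f + traceRight f' := by
  refine Tendsto.limUnder_eq ((h.tendsto_right.add h'.tendsto_right).congr' ?_)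
  exact (Lp.coeFn_add f f').symm.filter_mono inf_le_right

lemma HasWeakDeriv.traceLeft_add {f g f' g' : L2} (h : HasWeakDeriv f g)
    (h' : HasWeakDeriv f' g') : traceLeft (f + f') = traceLeft f + traceLeft f' := by
  refine Tendsto.limUnder_eq ((h.tendsto_left.add h'.tendsto_left).congr' ?_)
  exact (Lp.coeFn_add f f').symm.filter_mono inf_le_right

lemma HasWeakDeriv.traceRight_smul {f g : L2} (c : ℂ) (h : HasWeakDeriv f g) :
    traceRight (c • f) = c * traceRight f := by
  refine Tendsto.limUnder_eq ((h.tendsto_right.const_smul c).congr' ?_)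
  exact (Lp.coeFn_smul c f).symm.filter_mono inf_le_right

lemma HasWeakDeriv.traceLeft_smul {f g : L2} (c : ℂ) (h : HasWeakDeriv f g) :
    traceLeft (c • f) = c * traceLeft f := by
  refine Tendsto.limUnder_eq ((h.tendsto_left.const_smul c).congr' ?_)
  exact (Lp.coeFn_smul c f).symm.filter_mono inf_le_right

/-! ### The Sobolev space, the boundary maps and the operators -/

/-- The Sobolev space of order two over the nonzero reals: the functions in `L2` that have weak
derivatives of orders one and two in `L2`. -/
def W22 : Submodule ℂ L2 where
  carrier := {f | ∃ g h, HasWeakDeriv f g ∧ HasWeakDeriv g h}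
  zero_mem' := ⟨0, 0, .zero, .zero⟩
  add_mem' := by
    rintro _ _ ⟨g, h, h1, h2⟩ ⟨g', h', h1', h2'⟩
    exact ⟨g + g', h + h', h1.add h1', h2.add h2'⟩
  smul_mem' := by
    rintro c _ ⟨g, h, h1, h2⟩
    exact ⟨c • g, c • h, h1.smul c, h2.smul c⟩

lemma W22.hasWeakDeriv (f : W22) : HasWeakDeriv (f : L2) (weakDeriv f) := by
  obtain ⟨f, g, h, h1, h2⟩ := f
  simpa only [h1.weakDeriv_eq] using h1

lemma W22.hasWeakDeriv_two (f : W22) :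
    HasWeakDeriv (weakDeriv (f : L2)) (weakDeriv (weakDeriv f)) := by
  obtain ⟨f, g, h, h1, h2⟩ := f
  simpa only [h1.weakDeriv_eq, h2.weakDeriv_eq] using h2

lemma W22.weakDeriv_add (f g : W22) :
    weakDeriv ((f + g : W22) : L2) = weakDeriv f + weakDeriv g :=
  ((W22.hasWeakDeriv f).add (W22.hasWeakDeriv g)).weakDeriv_eq

lemma W22.weakDeriv_smul (c : ℂ) (f : W22) :
    weakDeriv ((c • f : W22) : L2) = c • weakDeriv (f : L2) :=
  ((W22.hasWeakDeriv f).smul c).weakDeriv_eq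

/-- `Γ₀ f = (f_r(0), -f_r'(0))`, with the mean values of the one-sided limits at the origin. -/
def Gamma0 : W22 →ₗ[ℂ] (Fin 2 → ℂ) where
  toFun f := ![(traceRight f + traceLeft f) / 2,
    -((traceRight (weakDeriv f) + traceLeft (weakDeriv f)) / 2)]
  map_add' f g := by
    rw [W22.weakDeriv_add, (W22.hasWeakDeriv_two f).traceRight_add (W22.hasWeakDeriv_two g),
      (W22.hasWeakDeriv_two f).traceLeft_add (W22.hasWeakDeriv_two g), Submodule.coe_add,
      (W22.hasWeakDeriv f).traceRight_add (W22.hasWeakDeriv g), (W22.hasWeakDeriv f).traceLeft_add (W22.hasWeakDeriv g)]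
    ext i
    fin_cases i <;> simp <;> ring
  map_smul' c f := by
    rw [W22.weakDeriv_smul, (W22.hasWeakDeriv_two f).traceRight_smul,
      (W22.hasWeakDeriv_two f).traceLeft_smul, Submodule.coe_smul,
      (W22.hasWeakDeriv f).traceRight_smul, (W22.hasWeakDeriv f).traceLeft_smul]
    ext i
    fin_cases i <;> simp <;> ring

/-- `Γ₁ f = (f_s'(0) - (q₁, f), f_s(0) - (q₂, f))`, with the jumps at the origin. -/
def Gamma1 (q₁ q₂ : L2) : W22 →ₗ[ℂ] (Fin 2 → ℂ) where
  toFun f := ![traceRight (weakDeriv f) - traceLeft (weakDeriv f) - inner ℂ q₁ (f : L2),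
    traceRight f - traceLeft f - inner ℂ q₂ (f : L2)]
  map_add' f g := by
    rw [W22.weakDeriv_add, (W22.hasWeakDeriv_two f).traceRight_add (W22.hasWeakDeriv_two g),
      (W22.hasWeakDeriv_two f).traceLeft_add (W22.hasWeakDeriv_two g), Submodule.coe_add,
      (W22.hasWeakDeriv f).traceRight_add (W22.hasWeakDeriv g), (W22.hasWeakDeriv f).traceLeft_add (W22.hasWeakDeriv g),
      inner_add_right, inner_add_right]
    ext i
    fin_cases i <;> simp <;> ring
  map_smul' c f := by
    rw [W22.weakDeriv_smul, (W22.hasWeakDeriv_two f).traceRight_smul,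
      (W22.hasWeakDeriv_two f).traceLeft_smul, Submodule.coe_smul,
      (W22.hasWeakDeriv f).traceRight_smul, (W22.hasWeakDeriv f).traceLeft_smul,
      inner_smul_right, inner_smul_right]
    ext i
    fin_cases i <;> simp <;> ring

/-- The maximal operator `S_max f = -f'' + f_r(0) q₁ - f_r'(0) q₂` on `W22`, where `f''` is taken
away from the origin. -/
def Smax (q₁ q₂ : L2) : L2 →ₗ.[ℂ] L2 where
  domain := W22
  toFun :=
    { toFun f := -weakDeriv (weakDeriv (f : L2)) + Gamma0 f 0 • q₁ + Gamma0 f 1 • q₂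
      map_add' f g := by
        rw [W22.weakDeriv_add, ((W22.hasWeakDeriv_two f).add (W22.hasWeakDeriv_two g)).weakDeriv_eq, map_add,
          Pi.add_apply, Pi.add_apply]
        module
      map_smul' c f := by
        rw [W22.weakDeriv_smul, ((W22.hasWeakDeriv_two f).smul c).weakDeriv_eq, map_smul,
          Pi.smul_apply, Pi.smul_apply, RingHom.id_apply, smul_eq_mul, smul_eq_mul]
        module }

/-- The operator `H_T`: the restriction of `S_max` to the `f` in `W22` with `T Γ₀ f = Γ₁ f`. -/
def H (T : Matrix (Fin 2) (Fin 2) ℂ) (q₁ q₂ : L2) : L2 →ₗ.[ℂ] L2 :=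
  (Smax q₁ q₂).domRestrict
    ((LinearMap.ker (T.mulVecLin ∘ₗ Gamma0 - Gamma1 q₁ q₂)).map W22.subtype)

end NonlocalPoint

end

open scoped ComplexConjugate

noncomputable section

namespace NonlocalPoint

/-! Self-adjointness follows from symmetry together with surjectivity of `H T q₁ q₂ + κ²` for one
real `κ ≠ 0` (`isSelfAdjoint_of_surjective`).

Symmetry is Green's identity (`green`), obtained from integration by parts on both half-lines: the
boundary form depends only on `Gamma0` and `Gamma1`, and it cancels on the domain because `T` is
Hermitian.

For surjectivity, a symmetric operator in a separable space has at most countably many real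
eigenvalues, so some `-κ² < 0` is not one of them. The boundary value problem `boundaryProblem`,
which pairs `Smax + κ²` with `T Γ₀ - Γ₁`, is then injective. It differs by a map of finite rank from
the Neumann problem without `q₁`, `q₂`, which is solvable for all data by a Hilbert space projection
(`neumannProblem_surjective`). As in the Fredholm alternative, injectivity then gives surjectivity
(`surjective_add_of_finiteRank`). No resolvent formula or smallness of `q₁`, `q₂` is needed. -/

/-! ### Primitives and integration by parts on the half-lines. -/

/-- Increments are dominated by those of the primitive of `‖p‖`, which reduces the complex case to a
real one. -/
lemma absolutelyContinuousOnInterval_primitive {p : ℝ → ℂ}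
    (hp : ∀ a b, IntervalIntegrable p volume a b) {a b c : ℝ} (hc : c ∈ uIcc a b) :
    AbsolutelyContinuousOnInterval (fun x => ∫ t in c..x, p t) a b := by
  have h := (hp a b).norm.absolutelyContinuousOnInterval_intervalIntegral hc
  unfold AbsolutelyContinuousOnInterval at h ⊢
  refine squeeze_zero (fun E => Finset.sum_nonneg fun i _ => dist_nonneg) (fun E => ?_) h
  refine Finset.sum_le_sum fun i _ => ?_
  rw [dist_eq_norm, Real.dist_eq, intervalIntegral.integral_interval_sub_left (hp _ _) (hp _ _),
    intervalIntegral.integral_interval_sub_left (hp _ _).norm (hp _ _).norm]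
  exact intervalIntegral.norm_integral_le_abs_integral_norm

lemma continuous_primitive_add {p : ℝ → ℂ} (hp : ∀ a b, IntervalIntegrable p volume a b) (A : ℂ) :
    Continuous fun x => A + ∫ t in 0..x, p t :=
  continuous_const.add (intervalIntegral.continuous_primitive hp 0)

lemma intervalIntegrable_deriv_primitive_mul {p q : ℝ → ℂ}
    (hp : ∀ a b, IntervalIntegrable p volume a b) (hq : ∀ a b, IntervalIntegrable q volume a b)
    (A B : ℂ) (a b : ℝ) : IntervalIntegrable
      (fun x => p x * (B + ∫ t in 0..x, q t) + (A + ∫ t in 0..x, p t) * q x) volume a b :=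
  ((hp a b).mul_continuousOn (continuous_primitive_add hq B).continuousOn).add
    ((hq a b).continuousOn_mul (continuous_primitive_add hp A).continuousOn)

/-- The product rule for indefinite integrals, in integrated form. -/
lemma integral_deriv_primitive_mul {p q : ℝ → ℂ}
    (hp : ∀ a b, IntervalIntegrable p volume a b) (hq : ∀ a b, IntervalIntegrable q volume a b)
    (A B : ℂ) (r : ℝ) :
    ∫ x in 0..r, (p x * (B + ∫ t in 0..x, q t) + (A + ∫ t in 0..x, p t) * q x) =
      (A + ∫ t in 0..r, p t) * (B + ∫ t in 0..r, q t) - A * B := by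
  set w : ℝ → ℂ := fun x => p x * (B + ∫ t in 0..x, q t) + (A + ∫ t in 0..x, p t) * q x with hw
  have hwi : ∀ a b, IntervalIntegrable w volume a b :=
    intervalIntegrable_deriv_primitive_mul hp hq A B
  have h0 : (0 : ℝ) ∈ uIcc 0 r := left_mem_uIcc
  have hconst (C : ℂ) : AbsolutelyContinuousOnInterval (fun _ : ℝ => C) 0 r :=
    contDiff_const.contDiffOn.absolutelyContinuousOnInterval
  have hP := (hconst A).fun_add (absolutelyContinuousOnInterval_primitive hp h0)
  have hQ := (hconst B).fun_add (absolutelyContinuousOnInterval_primitive hq h0)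
  -- The product minus the primitive of its formal derivative is absolutely continuous with zero
  -- derivative a.e., hence constant; comparing the values at `0` and `r` gives the formula.
  have hac := (hP.fun_smul hQ).fun_sub (absolutelyContinuousOnInterval_primitive hwi h0)
  obtain ⟨C, hC⟩ := hac.const_of_ae_hasDerivAt_zero (by
    filter_upwards [(hp 0 r).ae_hasDerivAt_integral, (hq 0 r).ae_hasDerivAt_integral,
      (hwi 0 r).ae_hasDerivAt_integral] with x h1 h2 h3 hx
    have := ((((h1 hx 0 h0).const_add A).fun_smul ((h2 hx 0 h0).const_add B)).fun_sub (h3 hx 0 h0))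
    convert this using 1
    simp only [hw, smul_eq_mul]
    ring)
  have e0 := hC 0 h0
  have er := hC r right_mem_uIcc
  simp only [intervalIntegral.integral_same, smul_eq_mul] at e0 er
  linear_combination e0 - er

/-- Integrability of the derivative makes the product converge at infinity, and integrability of the
product over a set of infinite measure forces that limit to be zero. Only the boundary term at `0`
survives. -/
lemma integral_Ioi_deriv_primitive_mul {p q : ℝ → ℂ}
    (hp : ∀ a b, IntervalIntegrable p volume a b) (hq : ∀ a b, IntervalIntegrable q volume a b)
    (A B : ℂ)
    (hd : IntegrableOn
      (fun x => p x * (B + ∫ t in 0..x, q t) + (A + ∫ t in 0..x, p t) * q x) (Ioi 0))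
    (hi : IntegrableOn (fun x => (A + ∫ t in 0..x, p t) * (B + ∫ t in 0..x, q t)) (Ioi 0)) :
    ∫ x in Ioi 0, (p x * (B + ∫ t in 0..x, q t) + (A + ∫ t in 0..x, p t) * q x) = -(A * B) := by
  have h1 := (intervalIntegral_tendsto_integral_Ioi 0 hd tendsto_id).add_const (A * B)
  simp only [id, integral_deriv_primitive_mul hp hq, sub_add_cancel] at h1
  have h2 := IntegrableAtFilter.eq_zero_of_tendsto
    (⟨Ioi 0, Ioi_mem_atTop _, hi⟩ : IntegrableAtFilter _ atTop) (fun s hs => by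
      rcases mem_atTop_sets.1 hs with ⟨b, hb⟩
      rw [← top_le_iff, ← Real.volume_Ici (a := b)]
      exact measure_mono hb) h1
  linear_combination h2

lemma integral_Iic_deriv_primitive_mul {p q : ℝ → ℂ}
    (hp : ∀ a b, IntervalIntegrable p volume a b) (hq : ∀ a b, IntervalIntegrable q volume a b)
    (A B : ℂ)
    (hd : IntegrableOn
      (fun x => p x * (B + ∫ t in 0..x, q t) + (A + ∫ t in 0..x, p t) * q x) (Iic 0))
    (hi : IntegrableOn (fun x => (A + ∫ t in 0..x, p t) * (B + ∫ t in 0..x, q t)) (Iic 0)) :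
    ∫ x in Iic 0, (p x * (B + ∫ t in 0..x, q t) + (A + ∫ t in 0..x, p t) * q x) = A * B := by
  have h1 := (intervalIntegral_tendsto_integral_Iic 0 hd tendsto_id).const_sub (A * B)
  simp only [id, intervalIntegral.integral_symm (0 : ℝ),
    integral_deriv_primitive_mul hp hq, sub_neg_eq_add, add_sub_cancel] at h1
  have h2 := IntegrableAtFilter.eq_zero_of_tendsto
    (⟨Iic 0, Iic_mem_atBot _, hi⟩ : IntegrableAtFilter _ atBot) (fun s hs => by
      rcases mem_atBot_sets.1 hs with ⟨b, hb⟩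
      rw [← top_le_iff, ← Real.volume_Iic (a := b)]
      exact measure_mono hb) h1
  linear_combination -h2

/-- The bounded-interval representation holds on each `(0, n + 1)`; uniqueness of the limit at `0`
identifies its constant with the trace, so the formulas for all `n` agree. -/
lemma HasWeakDeriv.ae_eq_right {f g : L2} (h : HasWeakDeriv f g) :
    ∀ᵐ x, 0 < x → f x = traceRight f + ∫ t in 0..x, g t := by
  have key (n : ℕ) : ∀ᵐ x, x ∈ Ioo (0 : ℝ) (n + 1) → f x = traceRight f + ∫ t in 0..x, g t := by
    have hn : (0 : ℝ) < n + 1 := by positivity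
    obtain ⟨C, hC⟩ := ae_eq_primitive f g (α := 0) (β := n + 1) hn (by simp) h
    have hc := continuous_primitive_add (intervalIntegrable_coe g) C
    have ht : Tendsto f (𝓝[>] (0 : ℝ) ⊓ ae volume) (𝓝 (C + ∫ t in 0..0, g t)) := by
      refine ((hc.tendsto 0).mono_left (inf_le_left.trans nhdsWithin_le_nhds)).congr' ?_
      have hI : ∀ᶠ x in 𝓝[>] (0 : ℝ), x ∈ Ioo (0 : ℝ) (n + 1) := Ioo_mem_nhdsGT hn
      filter_upwards [hI.filter_mono inf_le_left, hC.filter_mono inf_le_right] with x h1 h2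
      exact (h2 h1).symm
    have : traceRight f = C := by
      rw [tendsto_nhds_unique h.tendsto_right ht, intervalIntegral.integral_same, add_zero]
    rwa [this]
  filter_upwards [ae_all_iff.mpr key] with x hx h0
  obtain ⟨n, hn⟩ := exists_nat_gt x
  exact hx n ⟨h0, hn.trans (lt_add_one _)⟩

lemma HasWeakDeriv.ae_eq_left {f g : L2} (h : HasWeakDeriv f g) :
    ∀ᵐ x, x < 0 → f x = traceLeft f + ∫ t in 0..x, g t := by
  have key (n : ℕ) : ∀ᵐ x, x ∈ Ioo (-(n + 1) : ℝ) 0 → f x = traceLeft f + ∫ t in 0..x, g t := by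
    have hn : (-(n + 1) : ℝ) < 0 := neg_lt_zero.mpr (by positivity)
    obtain ⟨C, hC⟩ := ae_eq_primitive f g (β := 0) hn (by simp) h
    -- Moves the base point of the primitive from the left endpoint, which depends on `n`, to `0`.
    set D : ℂ := C + ∫ t in (-(n + 1) : ℝ)..0, g t with hD
    have hC' : ∀ᵐ x, x ∈ Ioo (-(n + 1) : ℝ) 0 → f x = D + ∫ t in 0..x, g t := by
      filter_upwards [hC] with x hx hI
      rw [hx hI, hD, add_assoc, intervalIntegral.integral_add_adjacent_intervals
        (intervalIntegrable_coe g _ _) (intervalIntegrable_coe g _ _)]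
    have hc := continuous_primitive_add (intervalIntegrable_coe g) D
    have ht : Tendsto f (𝓝[<] (0 : ℝ) ⊓ ae volume) (𝓝 (D + ∫ t in 0..0, g t)) := by
      refine ((hc.tendsto 0).mono_left (inf_le_left.trans nhdsWithin_le_nhds)).congr' ?_
      have hI : ∀ᶠ x in 𝓝[<] (0 : ℝ), x ∈ Ioo (-(n + 1) : ℝ) 0 := Ioo_mem_nhdsLT hn
      filter_upwards [hI.filter_mono inf_le_left, hC'.filter_mono inf_le_right] with x h1 h2
      exact (h2 h1).symm
    have : traceLeft f = D := by
      rw [tendsto_nhds_unique h.tendsto_left ht, intervalIntegral.integral_same, add_zero]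
    rwa [this]
  filter_upwards [ae_all_iff.mpr key] with x hx h0
  obtain ⟨n, hn⟩ := exists_nat_gt (-x)
  exact hx n ⟨by linarith, h0⟩

/-- Integration by parts on the two half-lines. -/
lemma HasWeakDeriv.inner_add_inner {u u' v v' : L2} (hu : HasWeakDeriv u u')
    (hv : HasWeakDeriv v v') :
    inner ℂ u' v + inner ℂ u v' =
      conj (traceLeft u) * traceLeft v - conj (traceRight u) * traceRight v := by
  set p : ℝ → ℂ := fun x => conj (u' x) with hp
  have hpi : ∀ a b, IntervalIntegrable p volume a b := fun a b =>
    have h := intervalIntegrable_coe u' a b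
    ⟨(Complex.conjCLE.toContinuousLinearMap.integrable_comp h.1),
      (Complex.conjCLE.toContinuousLinearMap.integrable_comp h.2)⟩
  have hqi := intervalIntegrable_coe v'
  have hpc (A : ℂ) (x : ℝ) : conj (A + ∫ t in 0..x, u' t) = conj A + ∫ t in 0..x, p t := by
    rw [map_add, hp, intervalIntegral.intervalIntegral_conj]
  have hI : Integrable fun x => conj (u' x) * v x + conj (u x) * v' x := by
    simpa [mul_comm] using (L2.integrable_inner (𝕜 := ℂ) u' v).fun_add
      (L2.integrable_inner (𝕜 := ℂ) u v')
  have hI0 : Integrable fun x => conj (u x) * v x := by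
    simpa [mul_comm] using L2.integrable_inner (𝕜 := ℂ) u v
  have e : inner ℂ u' v + inner ℂ u v' = ∫ x, (conj (u' x) * v x + conj (u x) * v' x) := by
    rw [L2.inner_def, L2.inner_def, ← integral_add (L2.integrable_inner (𝕜 := ℂ) u' v)
      (L2.integrable_inner (𝕜 := ℂ) u v')]
    simp [mul_comm]
  have hR : ∀ᵐ x ∂volume.restrict (Ioi (0 : ℝ)),
      conj (u x) = conj (traceRight u) + ∫ t in 0..x, p t := by
    filter_upwards [ae_restrict_mem measurableSet_Ioi, ae_restrict_of_ae hu.ae_eq_right]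
      with x h0 h1
    rw [h1 h0, hpc]
  have hR' : ∀ᵐ x ∂volume.restrict (Ioi (0 : ℝ)), v x = traceRight v + ∫ t in 0..x, v' t := by
    filter_upwards [ae_restrict_mem measurableSet_Ioi, ae_restrict_of_ae hv.ae_eq_right]
      with x h0 h1 using h1 h0
  have hne : ∀ᵐ x : ℝ ∂volume.restrict (Iic 0), x ≠ 0 := ae_restrict_of_ae (Measure.ae_ne _ _)
  have hL : ∀ᵐ x ∂volume.restrict (Iic (0 : ℝ)),
      conj (u x) = conj (traceLeft u) + ∫ t in 0..x, p t := by
    filter_upwards [ae_restrict_mem measurableSet_Iic, hne, ae_restrict_of_ae hu.ae_eq_left]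
      with x h0 hx h1
    rw [h1 (lt_of_le_of_ne h0 hx), hpc]
  have hL' : ∀ᵐ x ∂volume.restrict (Iic (0 : ℝ)), v x = traceLeft v + ∫ t in 0..x, v' t := by
    filter_upwards [ae_restrict_mem measurableSet_Iic, hne, ae_restrict_of_ae hv.ae_eq_left]
      with x h0 hx h1 using h1 (lt_of_le_of_ne h0 hx)
  have dR : ∀ᵐ x ∂volume.restrict (Ioi (0 : ℝ)), conj (u' x) * v x + conj (u x) * v' x =
      p x * (traceRight v + ∫ t in 0..x, v' t) +
        (conj (traceRight u) + ∫ t in 0..x, p t) * v' x := by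
    filter_upwards [hR, hR'] with x h1 h2
    rw [h1, h2]
  have dL : ∀ᵐ x ∂volume.restrict (Iic (0 : ℝ)), conj (u' x) * v x + conj (u x) * v' x =
      p x * (traceLeft v + ∫ t in 0..x, v' t) +
        (conj (traceLeft u) + ∫ t in 0..x, p t) * v' x := by
    filter_upwards [hL, hL'] with x h1 h2
    rw [h1, h2]
  have eR := integral_Ioi_deriv_primitive_mul hpi hqi (conj (traceRight u)) (traceRight v)
    (hI.integrableOn.congr dR) (hI0.integrableOn.congr (by
      filter_upwards [hR, hR'] with x h1 h2
      rw [h1, h2]))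
  have eL := integral_Iic_deriv_primitive_mul hpi hqi (conj (traceLeft u)) (traceLeft v)
    (hI.integrableOn.congr dL) (hI0.integrableOn.congr (by
      filter_upwards [hL, hL'] with x h1 h2
      rw [h1, h2]))
  rw [e, ← intervalIntegral.integral_Iic_add_Ioi hI.integrableOn hI.integrableOn,
    integral_congr_ae dL, integral_congr_ae dR, eL, eR, sub_eq_add_neg]

/-! ### Abstract tools: finite rank perturbations and symmetric operators. -/

/-- A finite rank perturbation of a surjective linear map is surjective as soon as it is
injective. -/
lemma surjective_add_of_finiteRank {K V W : Type*} [Field K] [AddCommGroup V] [Module K V]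
    [AddCommGroup W] [Module K W] {B F : V →ₗ[K] W} (hB : Function.Surjective B)
    [FiniteDimensional K (LinearMap.range F)] (hinj : Function.Injective (B + F)) :
    Function.Surjective (B + F) := by
  obtain ⟨G, hG⟩ := B.exists_rightInverse_of_surjective (LinearMap.range_eq_top.mpr hB)
  have hBG (w : W) : B (G w) = w := LinearMap.congr_fun hG w
  -- With `G` a right inverse of `B`, `(B + F) ∘ G = id + F ∘ G` preserves the range of `F`. There
  -- it is an injective endomorphism of a finite-dimensional space, so some `r` in that range solves
  -- `L r = -F (G w)`, and `G (w + r)` is a preimage of `w`.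
  let L : LinearMap.range F →ₗ[K] LinearMap.range F :=
    LinearMap.id + F.rangeRestrict ∘ₗ G ∘ₗ (LinearMap.range F).subtype
  have hL (r : LinearMap.range F) : (L r : W) = (B + F) (G r) := by
    simp [L, hBG]
  have hLinj : Function.Injective L := fun r s hrs => by
    have h1 : (B + F) (G r) = (B + F) (G s) := by rw [← hL, ← hL, hrs]
    have h2 := congrArg B (hinj h1)
    rw [hBG, hBG] at h2
    exact Subtype.ext h2
  intro w
  obtain ⟨r, hr⟩ := LinearMap.injective_iff_surjective.mp hLinj (-(F.rangeRestrict (G w)))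
  refine ⟨G (w + r), ?_⟩
  have h := congrArg (Subtype.val) hr
  rw [hL] at h
  rw [map_add G, map_add, h]
  simp [hBG]

section

variable {E : Type*} [NormedAddCommGroup E] [InnerProductSpace ℂ E]

open scoped LinearPMap InnerProductSpace

/-- A symmetric operator `A` with `A + t` onto for some real `t` is self-adjoint. -/
lemma isSelfAdjoint_of_surjective [CompleteSpace E] {A : E →ₗ.[ℂ] E} (hA : A.IsFormalAdjoint A)
    (t : ℝ) (hsurj : ∀ h, ∃ x : A.domain, A x + (t : ℂ) • (x : E) = h) : IsSelfAdjoint A := by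
  have hsym (x y : A.domain) :
      ⟪A x + (t : ℂ) • (x : E), (y : E)⟫_ℂ = ⟪(x : E), A y + (t : ℂ) • (y : E)⟫_ℂ := by
    rw [inner_add_left, inner_add_right, hA x y, inner_smul_left, inner_smul_right,
      Complex.conj_ofReal]
  have hdense : Dense (A.domain : Set E) := by
    rw [Submodule.dense_iff_topologicalClosure_eq_top, Submodule.topologicalClosure_eq_top_iff,
      Submodule.eq_bot_iff]
    intro h hh
    -- For `h` orthogonal to the domain, write `h = (A + t) g` and `g = (A + t) x`; then `0 = ⟪x, (A
    -- + t) g⟫ = ⟪(A + t) x, g⟫ = ‖g‖²`.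
    obtain ⟨g, rfl⟩ := hsurj h
    obtain ⟨x, hx⟩ := hsurj g
    have h1 : ⟪(x : E), A g + (t : ℂ) • (g : E)⟫_ℂ = 0 := hh x x.2
    rw [← hsym, hx, inner_self_eq_zero] at h1
    have : g = 0 := Subtype.ext h1
    simp [this]
  have hle : A ≤ A† := hA.le_adjoint hdense
  have had := LinearPMap.adjoint_isFormalAdjoint hdense
  refine (LinearPMap.eq_of_le_of_domain_eq hle (le_antisymm hle.1 fun y hy => ?_)).symm
  -- Here `g` lies in the domain of `A` and `y - g` is orthogonal to the range of `A + t`, which is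
  -- everything; hence `y = g`.
  obtain ⟨g, hg⟩ := hsurj (A† ⟨y, hy⟩ + (t : ℂ) • y)
  obtain ⟨x, hx⟩ := hsurj (y - g)
  have h1 : ⟪y, A x + (t : ℂ) • (x : E)⟫_ℂ = ⟪A† ⟨y, hy⟩ + (t : ℂ) • y, (x : E)⟫_ℂ := by
    rw [inner_add_left, inner_add_right, had ⟨y, hy⟩ x, inner_smul_left, inner_smul_right,
      Complex.conj_ofReal]
  rw [← hg, hsym g x, ← sub_eq_zero, ← inner_sub_left, hx, inner_self_eq_zero, sub_eq_zero] at h1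
  exact h1 ▸ g.2

/-- A symmetric operator in a separable space has at most countably many real eigenvalues. -/
lemma countable_eigenvalues [TopologicalSpace.SeparableSpace E] {A : E →ₗ.[ℂ] E}
    (hA : A.IsFormalAdjoint A) :
    {t : ℝ | ∃ x : A.domain, (x : E) ≠ 0 ∧ A x = (t : ℂ) • (x : E)}.Countable := by
  set S := {t : ℝ | ∃ x : A.domain, (x : E) ≠ 0 ∧ A x = (t : ℂ) • (x : E)} with hS
  choose! v hv0 hv using fun t (ht : t ∈ S) => ht
  set w : ℝ → E := fun t => ((‖(v t : E)‖ : ℂ)⁻¹) • (v t : E) with hw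
  have hnorm {t : ℝ} (ht : t ∈ S) : ‖w t‖ = 1 := norm_smul_inv_norm (𝕜 := ℂ) (hv0 t ht)
  have horth {s t : ℝ} (hs : s ∈ S) (ht : t ∈ S) (hst : s ≠ t) : ⟪w s, w t⟫_ℂ = 0 := by
    have h := hA (v s) (v t)
    rw [hv s hs, hv t ht, inner_smul_left, inner_smul_right, Complex.conj_ofReal] at h
    have h2 : ((s : ℂ) - t) * ⟪(v s : E), (v t : E)⟫_ℂ = 0 := by linear_combination h
    rcases mul_eq_zero.mp h2 with h3 | h3
    · exact absurd (by exact_mod_cast sub_eq_zero.mp h3) hst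
    · simp [hw, h3]
  -- Orthonormal eigenvectors are at mutual distance `√2 ≥ 1`, so balls of radius `1 / 2` are
  -- disjoint, and separability permits only countably many.
  refine PairwiseDisjoint.countable_of_isOpen (s := fun t => Metric.ball (w t) (1 / 2)) ?_
    (fun _ _ => Metric.isOpen_ball) (fun t _ => ⟨w t, by simp⟩)
  intro s hs t ht hst
  refine Metric.ball_disjoint_ball ?_
  have h : ‖w s - w t‖ * ‖w s - w t‖ = 2 := by
    rw [@norm_sub_mul_self ℂ, horth hs ht hst, hnorm hs, hnorm ht]
    norm_num
  rw [dist_eq_norm]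
  nlinarith [norm_nonneg (w s - w t)]

end

/-! ### Explicit functions with weak derivatives: exponentials and test functions. -/

/-- A classical derivative away from the origin is a weak derivative. -/
lemma hasWeakDeriv_of_hasDerivAt {f g : L2} {F G : ℝ → ℂ} (hf : f =ᵐ[volume] F)
    (hg : g =ᵐ[volume] G) (hd : ∀ x, x ≠ 0 → HasDerivAt F (G x) x) : HasWeakDeriv f g := by
  intro φ hφ hc hs
  have hφd (x : ℝ) : HasDerivAt φ (deriv φ x) x :=
    (hφ.differentiable (by simp)).differentiableAt.hasDerivAt
  have h1 : Integrable fun x => deriv φ x • F x :=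
    (integrable_test f (hφ.continuous_deriv (by simp)) hc.deriv).congr
      (hf.mono fun x hx => congrArg (deriv φ x • ·) hx)
  have h2 : Integrable fun x => φ x • G x :=
    (integrable_test g hφ.continuous hc).congr
      (hg.mono fun x hx => congrArg (φ x • ·) hx)
  have h3 : Integrable fun x => φ x • F x :=
    (integrable_test f hφ.continuous hc).congr
      (hf.mono fun x hx => congrArg (φ x • ·) hx)
  have h0 : (0 : ℝ) ∉ tsupport φ := fun h => hs h rfl
  have hder (x : ℝ) : HasDerivAt (fun x => φ x • F x) (φ x • G x + deriv φ x • F x) x := by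
    rcases eq_or_ne x 0 with rfl | hx
    -- `F` may jump at the origin, but `φ` vanishes in a neighbourhood of it, so the product is
    -- differentiable there too.
    · have hz := notMem_tsupport_iff_eventuallyEq.mp h0
      have hz' : deriv φ 0 = 0 := by rw [hz.deriv_eq]; simp
      rw [hz.eq_of_nhds, hz']
      simp only [Pi.zero_apply, zero_smul, add_zero]
      refine (hasDerivAt_const 0 (0 : ℂ)).congr_of_eventuallyEq ?_
      filter_upwards [hz] with x hx
      rw [hx, Pi.zero_apply, zero_smul]
    · exact (hφd x).fun_smul (hd x hx)
  have key := integral_eq_zero_of_hasDerivAt_of_integrable hder (h2.add h1) h3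
  rw [integral_add h2 h1] at key
  rw [integral_congr_ae (hf.mono fun x hx => congrArg (deriv φ x • ·) hx :
      (fun x => deriv φ x • f x) =ᵐ[volume] fun x => deriv φ x • F x),
    integral_congr_ae (hg.mono fun x hx => congrArg (φ x • ·) hx :
      (fun x => φ x • g x) =ᵐ[volume] fun x => φ x • G x)]
  linear_combination key

/-- The function equal to `a e^{-x}` for `x > 0` and to `b e^x` for `x ≤ 0`. -/
def stepExpFun (a b : ℂ) (x : ℝ) : ℂ :=
  if 0 < x then a * (Real.exp (-x) : ℝ) else b * (Real.exp x : ℝ)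

lemma memLp_stepExpFun (a b : ℂ) : MemLp (stepExpFun a b) 2 volume := by
  have hm : Measurable (stepExpFun a b) :=
    Measurable.ite measurableSet_Ioi (by fun_prop) (by fun_prop)
  rw [memLp_two_iff_integrable_sq_norm hm.aestronglyMeasurable, ← integrableOn_univ,
    ← Iic_union_Ioi (a := (0 : ℝ))]
  refine IntegrableOn.union ?_ ?_
  · refine IntegrableOn.congr_fun
      ((integrableOn_exp_mul_Iic (a := 2) (by norm_num) 0).const_mul (‖b‖ ^ 2)) (fun x hx => ?_)
      measurableSet_Iic
    have : ¬ 0 < x := not_lt.mpr hx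
    simp only [stepExpFun, if_neg this, norm_mul, Complex.norm_real, Real.norm_eq_abs,
      Real.abs_exp, mul_pow, ← Real.exp_nat_mul]
    norm_num
  · refine IntegrableOn.congr_fun
      ((integrableOn_exp_mul_Ioi (a := -2) (by norm_num) 0).const_mul (‖a‖ ^ 2)) (fun x hx => ?_)
      measurableSet_Ioi
    have : 0 < x := hx
    simp only [stepExpFun, if_pos this, norm_mul, Complex.norm_real, Real.norm_eq_abs,
      Real.abs_exp, mul_pow, ← Real.exp_nat_mul]
    norm_num

/-- The class in `L2` of `stepExpFun a b`. -/
def stepExp (a b : ℂ) : L2 := (memLp_stepExpFun a b).toLp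

lemma coeFn_stepExp (a b : ℂ) : stepExp a b =ᵐ[volume] stepExpFun a b :=
  (memLp_stepExpFun a b).coeFn_toLp

/-- This family is closed under differentiation, satisfies `w'' = w` and realises every pair of
one-sided boundary values. -/
lemma hasWeakDeriv_stepExp (a b : ℂ) : HasWeakDeriv (stepExp a b) (stepExp (-a) b) := by
  refine hasWeakDeriv_of_hasDerivAt (coeFn_stepExp a b) (coeFn_stepExp (-a) b) fun x hx => ?_
  rcases lt_or_gt_of_ne hx with hx | hx
  · have h := ((Real.hasDerivAt_exp x).ofReal_comp).const_mul b
    simp only [stepExpFun, if_neg hx.not_gt]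
    refine h.congr_of_eventuallyEq ?_
    filter_upwards [Iio_mem_nhds hx] with y hy
    exact if_neg (not_lt.mpr (le_of_lt (mem_Iio.mp hy)))
  · have h := (((hasDerivAt_neg x).exp).ofReal_comp).const_mul a
    simp only [stepExpFun, if_pos hx]
    have e : -a * (Real.exp (-x) : ℝ) = a * ((Real.exp (-x) * -1 : ℝ) : ℂ) := by
      push_cast
      ring
    rw [e]
    refine h.congr_of_eventuallyEq ?_
    filter_upwards [Ioi_mem_nhds hx] with y hy
    exact if_pos (mem_Ioi.mp hy)

lemma traceRight_stepExp (a b : ℂ) : traceRight (stepExp a b) = a := by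
  have hc : Continuous fun x : ℝ => a * ((Real.exp (-x) : ℝ) : ℂ) := by fun_prop
  have h : Tendsto (fun x : ℝ => a * ((Real.exp (-x) : ℝ) : ℂ)) (𝓝[>] 0 ⊓ ae volume) (𝓝 a) := by
    simpa using (hc.tendsto 0).mono_left
      ((inf_le_left : 𝓝[>] (0 : ℝ) ⊓ ae volume ≤ _).trans nhdsWithin_le_nhds)
  refine Tendsto.limUnder_eq (h.congr' ?_)
  have hpos : ∀ᶠ x in 𝓝[>] (0 : ℝ), 0 < x := self_mem_nhdsWithin
  filter_upwards [(coeFn_stepExp a b).filter_mono inf_le_right, hpos.filter_mono inf_le_left]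
    with x h1 h2
  rw [h1, stepExpFun, if_pos h2]

lemma traceLeft_stepExp (a b : ℂ) : traceLeft (stepExp a b) = b := by
  have hc : Continuous fun x : ℝ => b * ((Real.exp x : ℝ) : ℂ) := by fun_prop
  have h : Tendsto (fun x : ℝ => b * ((Real.exp x : ℝ) : ℂ)) (𝓝[<] 0 ⊓ ae volume) (𝓝 b) := by
    simpa using (hc.tendsto 0).mono_left
      ((inf_le_left : 𝓝[<] (0 : ℝ) ⊓ ae volume ≤ _).trans nhdsWithin_le_nhds)
  refine Tendsto.limUnder_eq (h.congr' ?_)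
  have hneg : ∀ᶠ x in 𝓝[<] (0 : ℝ), x < 0 := self_mem_nhdsWithin
  filter_upwards [(coeFn_stepExp a b).filter_mono inf_le_right, hneg.filter_mono inf_le_left]
    with x h1 h2
  rw [h1, stepExpFun, if_neg h2.not_gt]

/-- The class in `L2` of a continuous function with compact support. -/
def testL2 {φ : ℝ → ℝ} (hφ : Continuous φ) (hc : HasCompactSupport φ) : L2 :=
  ((Complex.continuous_ofReal.comp hφ).memLp_of_hasCompactSupport
    (hc.comp_left Complex.ofReal_zero) : MemLp (Complex.ofReal ∘ φ) 2 volume).toLp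

lemma coeFn_testL2 {φ : ℝ → ℝ} (hφ : Continuous φ) (hc : HasCompactSupport φ) :
    testL2 hφ hc =ᵐ[volume] fun x => (φ x : ℂ) :=
  MemLp.coeFn_toLp _

lemma inner_testL2 {φ : ℝ → ℝ} (hφ : Continuous φ) (hc : HasCompactSupport φ) (f : L2) :
    inner ℂ (testL2 hφ hc) f = ∫ x, φ x • f x := by
  rw [L2.inner_def]
  refine integral_congr_ae ?_
  filter_upwards [coeFn_testL2 hφ hc] with x hx
  simp [hx, mul_comm]

lemma hasWeakDeriv_testL2 {φ : ℝ → ℝ} (hφ : ContDiff ℝ ∞ φ) (hc : HasCompactSupport φ) :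
    HasWeakDeriv (testL2 hφ.continuous hc)
      (testL2 (hφ.continuous_deriv (by simp)) hc.deriv) :=
  hasWeakDeriv_of_hasDerivAt (coeFn_testL2 _ _) (coeFn_testL2 _ _) fun _ _ =>
    ((hφ.differentiable (by simp)).differentiableAt.hasDerivAt).ofReal_comp

/-! ### Solvability of the Neumann problem. -/

/-- The pairs `(κ u, u')` with `u` in the Sobolev space of order one over the nonzero reals. -/
def energySpace (κ : ℝ) : Submodule ℂ (WithLp 2 (L2 × L2)) :=
  (Submodule.span ℂ {z | ∃ (φ : ℝ → ℝ) (hφ : ContDiff ℝ ∞ φ) (hc : HasCompactSupport φ),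
    tsupport φ ⊆ {0}ᶜ ∧ z = WithLp.toLp 2 (testL2 (hφ.continuous_deriv (by simp)) hc.deriv,
      (κ : ℂ) • testL2 hφ.continuous hc)})ᗮ

/-- The weak derivative relation is orthogonality to pairs built from test functions. Defining the
space as an orthogonal complement makes it closed, so projections onto it exist. -/
lemma mem_energySpace {κ : ℝ} {y : WithLp 2 (L2 × L2)} :
    y ∈ energySpace κ ↔ HasWeakDeriv y.fst ((κ : ℂ) • y.snd) := by
  have hin {φ : ℝ → ℝ} (hφ : ContDiff ℝ ∞ φ) (hc : HasCompactSupport φ) :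
      inner ℂ (WithLp.toLp 2 (testL2 (hφ.continuous_deriv (by simp)) hc.deriv,
        (κ : ℂ) • testL2 hφ.continuous hc)) y =
        (∫ x, deriv φ x • y.fst x) + ∫ x, φ x • ((κ : ℂ) • y.snd) x := by
    rw [WithLp.prod_inner_apply, inner_smul_left, Complex.conj_ofReal, ← inner_smul_right,
      inner_testL2, inner_testL2]
    rfl
  rw [energySpace, Submodule.mem_orthogonal]
  constructor
  · intro h φ hφ hc hs
    have := h _ (Submodule.subset_span ⟨φ, hφ, hc, hs, rfl⟩)
    rw [hin hφ hc] at this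
    exact eq_neg_of_add_eq_zero_left this
  · intro h z hz
    induction hz using Submodule.span_induction with
    | mem z hz =>
      obtain ⟨φ, hφ, hc, hs, rfl⟩ := hz
      rw [hin hφ hc, h φ hφ hc hs, neg_add_cancel]
    | zero => exact inner_zero_left _
    | add z w _ _ hz hw => rw [inner_add_left, hz, hw, add_zero]
    | smul c z _ hz => rw [inner_smul_left, hz, mul_zero]

/-- The variational form of the equation `-u'' + κ² u = h` with Neumann conditions. -/
lemma exists_variational_solution {κ : ℝ} (hκ : κ ≠ 0) (h : L2) :
    ∃ u u' : L2, HasWeakDeriv u u' ∧ ∀ v v' : L2, HasWeakDeriv v v' →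
      inner ℂ u' v' = inner ℂ (h - ((κ ^ 2 : ℝ) : ℂ) • u) v := by
  have hκ' : (κ : ℂ) ≠ 0 := Complex.ofReal_ne_zero.mpr hκ
  have : (energySpace κ).HasOrthogonalProjection := by
    unfold energySpace
    infer_instance
  -- The projection of `(κ⁻¹ h, 0)` is `(κ u, u')`; orthogonality of the remainder to every `(κ v,
  -- v')` is the variational equation.
  set z : WithLp 2 (L2 × L2) := WithLp.toLp 2 ((κ : ℂ)⁻¹ • h, 0) with hz
  set y := (energySpace κ).starProjection z with hy
  have hyV : y ∈ energySpace κ := Submodule.starProjection_apply_mem _ _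
  refine ⟨(κ : ℂ)⁻¹ • y.fst, y.snd, ?_, fun v v' hv => ?_⟩
  · have := (mem_energySpace.mp hyV).smul (κ : ℂ)⁻¹
    rwa [smul_smul, inv_mul_cancel₀ hκ', one_smul] at this
  · have hw : WithLp.toLp 2 ((κ : ℂ) • v, v') ∈ energySpace κ :=
      mem_energySpace.mpr (hv.smul (κ : ℂ))
    have := Submodule.starProjection_inner_eq_zero z _ hw
    rw [← hy, WithLp.prod_inner_apply] at this
    have h2 : inner ℂ ((κ : ℂ)⁻¹ • h - y.fst) ((κ : ℂ) • v) + inner ℂ (0 - y.snd) v' = 0 := this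
    rw [zero_sub, inner_neg_left, inner_smul_right, inner_sub_left, inner_smul_left] at h2
    rw [inner_sub_left, inner_smul_left, inner_smul_left]
    simp only [map_inv₀, map_pow, Complex.conj_ofReal, Complex.ofReal_pow] at h2 ⊢
    field_simp at h2 ⊢
    linear_combination -h2

/-- Test functions in the variational equation yield `u''`. The Neumann conditions are its natural
boundary conditions: testing with `stepExp a b` leaves only boundary terms, with `a` and `b`
arbitrary. -/
lemma exists_neumann_solution {κ : ℝ} (hκ : κ ≠ 0) (h : L2) :
    ∃ u u' : L2, HasWeakDeriv u u' ∧ HasWeakDeriv u' (((κ ^ 2 : ℝ) : ℂ) • u - h) ∧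
      traceRight u' = 0 ∧ traceLeft u' = 0 := by
  obtain ⟨u, u', hu, hv⟩ := exists_variational_solution hκ h
  have hu' : HasWeakDeriv u' (((κ ^ 2 : ℝ) : ℂ) • u - h) := by
    intro φ hφ hc hs
    have := hv _ _ (hasWeakDeriv_testL2 hφ hc)
    rw [← inner_conj_symm, ← inner_conj_symm (h - _ : L2)] at this
    have := (starRingEnd ℂ).injective this
    rw [inner_testL2] at this
    rw [this, ← inner_testL2 hφ.continuous hc, ← inner_neg_right, neg_sub]
  have hb (a b : ℂ) : conj (traceLeft u') * b = conj (traceRight u') * a := by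
    have h1 := hu'.inner_add_inner (hasWeakDeriv_stepExp a b)
    rw [hv _ _ (hasWeakDeriv_stepExp a b), ← inner_add_left, sub_add_sub_cancel, sub_self,
      inner_zero_left, traceLeft_stepExp, traceRight_stepExp] at h1
    exact (sub_eq_zero.mp h1.symm)
  exact ⟨u, u', hu, hu', by simpa using (hb 1 0).symm, by simpa using hb 0 1⟩

/-- Adding `w = stepExp (-α) β`, whose derivative has traces `α` and `β`, reduces to homogeneous
conditions; since `w'' = w`, the new right-hand side is `h + w - κ² w`. -/
lemma exists_inhomogeneous_neumann_solution {κ : ℝ} (hκ : κ ≠ 0) (h : L2) (α β : ℂ) :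
    ∃ u u' : L2, HasWeakDeriv u u' ∧ HasWeakDeriv u' (((κ ^ 2 : ℝ) : ℂ) • u - h) ∧
      traceRight u' = α ∧ traceLeft u' = β := by
  have h1 := hasWeakDeriv_stepExp (-α) β
  have h2 := hasWeakDeriv_stepExp α β
  rw [neg_neg] at h1
  obtain ⟨u, u', hu, hu', hr, hl⟩ := exists_neumann_solution hκ
    (h + stepExp (-α) β - ((κ ^ 2 : ℝ) : ℂ) • stepExp (-α) β)
  refine ⟨u + stepExp (-α) β, u' + stepExp α β, hu.add h1, ?_, ?_, ?_⟩
  · convert hu'.add h2 using 1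
    module
  · rw [hu'.traceRight_add h2, hr, traceRight_stepExp, zero_add]
  · rw [hu'.traceLeft_add h2, hl, traceLeft_stepExp, zero_add]

/-! ### Green's identity and symmetry. -/

/-- Green's identity for `Smax`. -/
lemma green (q₁ q₂ : L2) (f g : W22) :
    inner ℂ (Smax q₁ q₂ f) (g : L2) - inner ℂ (f : L2) (Smax q₁ q₂ g) =
      conj (Gamma1 q₁ q₂ f 0) * Gamma0 g 0 + conj (Gamma1 q₁ q₂ f 1) * Gamma0 g 1 -
        (conj (Gamma0 f 0) * Gamma1 q₁ q₂ g 0 + conj (Gamma0 f 1) * Gamma1 q₁ q₂ g 1) := by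
  have h1 := (W22.hasWeakDeriv_two f).inner_add_inner (W22.hasWeakDeriv g)
  have h2 := (W22.hasWeakDeriv f).inner_add_inner (W22.hasWeakDeriv_two g)
  have ef : Smax q₁ q₂ f =
    -weakDeriv (weakDeriv (f : L2)) + Gamma0 f 0 • q₁ + Gamma0 f 1 • q₂ := rfl
  have eg : Smax q₁ q₂ g =
    -weakDeriv (weakDeriv (g : L2)) + Gamma0 g 0 • q₁ + Gamma0 g 1 • q₂ := rfl
  rw [ef, eg]
  simp only [inner_add_left, inner_add_right, inner_neg_left, inner_neg_right, inner_smul_left,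
    inner_smul_right]
  simp only [Gamma0, Gamma1, LinearMap.coe_mk, AddHom.coe_mk, Matrix.cons_val_zero,
    Matrix.cons_val_one, map_sub, map_add, map_neg, map_div₀, inner_conj_symm, map_ofNat]
  -- The terms `⟪f', g'⟫` cancel, the boundary terms regroup into means times jumps, and the `q₁`,
  -- `q₂` terms of `Smax` match those of `Gamma1`.
  linear_combination h2 - h1

lemma mem_H_domain_iff {T : Matrix (Fin 2) (Fin 2) ℂ} {q₁ q₂ x : L2} :
    x ∈ (H T q₁ q₂).domain ↔
      ∃ f : W22, (f : L2) = x ∧ T.mulVecLin (Gamma0 f) = Gamma1 q₁ q₂ f := by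
  constructor
  · rintro ⟨⟨f, hf, rfl⟩, -⟩
    exact ⟨f, rfl, sub_eq_zero.mp hf⟩
  · rintro ⟨f, rfl, hf⟩
    exact ⟨⟨f, sub_eq_zero.mpr hf, rfl⟩, f.2⟩

lemma H_apply {T : Matrix (Fin 2) (Fin 2) ℂ} {q₁ q₂ : L2} {x : (H T q₁ q₂).domain} {f : W22}
    (h : (x : L2) = f) : H T q₁ q₂ x = Smax q₁ q₂ f :=
  LinearPMap.domRestrict_apply (f := Smax q₁ q₂) h

lemma isFormalAdjoint_H {T : Matrix (Fin 2) (Fin 2) ℂ} (hT : T.IsHermitian) (q₁ q₂ : L2) :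
    (H T q₁ q₂).IsFormalAdjoint (H T q₁ q₂) := by
  intro x y
  obtain ⟨f, hfx, hf⟩ := mem_H_domain_iff.mp x.2
  obtain ⟨g, hgy, hg⟩ := mem_H_domain_iff.mp y.2
  rw [H_apply hfx.symm, H_apply hgy.symm, ← hfx, ← hgy, ← sub_eq_zero, green, ← hf, ← hg]
  have h (i j : Fin 2) : conj (T i j) = T j i := hT.apply j i
  simp only [Matrix.mulVecLin_apply, Matrix.mulVec, dotProduct, Fin.sum_univ_two, map_add,
    map_mul, h]
  ring

/-! ### The boundary value problem and self-adjointness. -/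

/-- The operator `Smax` as a linear map on `W22`. -/
def SmaxMap (q₁ q₂ : L2) : W22 →ₗ[ℂ] L2 := (Smax q₁ q₂).toFun

/-- The boundary value problem with the conditions of `H T` as a linear map. -/
def boundaryProblem (T : Matrix (Fin 2) (Fin 2) ℂ) (q₁ q₂ : L2) (t : ℂ) :
    W22 →ₗ[ℂ] L2 × (Fin 2 → ℂ) :=
  (SmaxMap q₁ q₂ + t • W22.subtype).prod (T.mulVecLin ∘ₗ Gamma0 - Gamma1 q₁ q₂)

/-- The Neumann boundary value problem as a linear map. -/
def neumannProblem (t : ℂ) : W22 →ₗ[ℂ] L2 × (Fin 2 → ℂ) :=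
  (SmaxMap 0 0 + t • W22.subtype).prod
    (LinearMap.pi ![LinearMap.proj 1 ∘ₗ Gamma0, LinearMap.proj 0 ∘ₗ Gamma1 0 0])

lemma neumannProblem_surjective {κ : ℝ} (hκ : κ ≠ 0) :
    Function.Surjective (neumannProblem ((κ ^ 2 : ℝ) : ℂ)) := by
  rintro ⟨h, c⟩
  -- These one-sided values of `u'` have mean `-c 0` and jump `c 1`.
  obtain ⟨u, u', h1, h2, hr, hl⟩ := exists_inhomogeneous_neumann_solution hκ h
    (-c 0 + c 1 / 2) (-c 0 - c 1 / 2)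
  have e2 : weakDeriv (weakDeriv u) = ((κ ^ 2 : ℝ) : ℂ) • u - h := by
    rw [h1.weakDeriv_eq, h2.weakDeriv_eq]
  refine ⟨⟨u, u', _, h1, h2⟩, Prod.ext ?_ ?_⟩
  · change -weakDeriv (weakDeriv u) + (_ : ℂ) • (0 : L2) + (_ : ℂ) • (0 : L2) + ((κ ^ 2 : ℝ) : ℂ) • u = h
    rw [e2, smul_zero, smul_zero]
    module
  · ext i
    fin_cases i
    · change -((traceRight (weakDeriv u) + traceLeft (weakDeriv u)) / 2) = c 0
      rw [h1.weakDeriv_eq, hr, hl]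
      ring
    · change traceRight (weakDeriv u) - traceLeft (weakDeriv u) - inner ℂ (0 : L2) u = c 1
      rw [h1.weakDeriv_eq, hr, hl, inner_zero_left]
      ring

/-- The difference from the Neumann problem takes values in `span {q₁, q₂} × ℂ²`: keeping the
boundary conditions as a component of the map lets both problems share the domain `W22`. -/
lemma boundaryProblem_surjective {T : Matrix (Fin 2) (Fin 2) ℂ} {q₁ q₂ : L2} {κ : ℝ} (hκ : κ ≠ 0)
    (hinj : Function.Injective (boundaryProblem T q₁ q₂ ((κ ^ 2 : ℝ) : ℂ))) :
    Function.Surjective (boundaryProblem T q₁ q₂ ((κ ^ 2 : ℝ) : ℂ)) := by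
  set Φ := boundaryProblem T q₁ q₂ ((κ ^ 2 : ℝ) : ℂ) with hΦ
  set B := neumannProblem ((κ ^ 2 : ℝ) : ℂ) with hB
  have hsum : Φ = B + (Φ - B) := (add_sub_cancel _ _).symm
  have : FiniteDimensional ℂ (LinearMap.range (Φ - B)) := by
    have hle : LinearMap.range (Φ - B) ≤ (Submodule.span ℂ {q₁, q₂}).prod ⊤ := by
      rintro _ ⟨f, rfl⟩
      refine ⟨?_, trivial⟩
      have e : ((Φ - B) f).1 = Gamma0 f 0 • q₁ + Gamma0 f 1 • q₂ := by
        change (-weakDeriv (weakDeriv (f : L2)) + Gamma0 f 0 • q₁ + Gamma0 f 1 • q₂ +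
          ((κ ^ 2 : ℝ) : ℂ) • (f : L2)) - (-weakDeriv (weakDeriv (f : L2)) +
            Gamma0 f 0 • (0 : L2) + Gamma0 f 1 • (0 : L2) + ((κ ^ 2 : ℝ) : ℂ) • (f : L2)) = _
        module
      rw [SetLike.mem_coe, e]
      exact Submodule.mem_span_pair.mpr ⟨_, _, rfl⟩
    have hfg : ((Submodule.span ℂ {q₁, q₂}).prod (⊤ : Submodule ℂ (Fin 2 → ℂ))).FG :=
      (Submodule.fg_span (by simp)).prod Module.Finite.fg_top
    have := Module.Finite.iff_fg.mpr hfg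
    exact Submodule.finiteDimensional_of_le hle
  rw [hsum] at hinj ⊢
  exact surjective_add_of_finiteRank (neumannProblem_surjective hκ) hinj

theorem isSelfAdjoint_H {T : Matrix (Fin 2) (Fin 2) ℂ} (hT : T.IsHermitian) (q₁ q₂ : L2) :
    IsSelfAdjoint (H T q₁ q₂) := by
  have hsym := isFormalAdjoint_H hT q₁ q₂
  -- Finiteness of the exponent gives separability of `L2`.
  have : Fact ((2 : ENNReal) ≠ ⊤) := ⟨by norm_num⟩
  -- A negative non-eigenvalue `t = -κ²`: a kernel element of the boundary problem would be an
  -- eigenvector of `H T q₁ q₂` for `t`.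
  obtain ⟨t, ht, htS⟩ := ((countable_eigenvalues hsym).dense_compl ℝ).inter_open_nonempty
    (Iio 0) isOpen_Iio ⟨-1, by simp⟩
  have ht0 : 0 < -t := neg_pos.mpr ht
  have hκ : √(-t) ≠ 0 := (Real.sqrt_pos.mpr ht0).ne'
  have hκt : √(-t) ^ 2 = -t := Real.sq_sqrt ht0.le
  have hinj : Function.Injective (boundaryProblem T q₁ q₂ ((√(-t) ^ 2 : ℝ) : ℂ)) := by
    rw [injective_iff_map_eq_zero]
    intro f hf
    by_contra hne
    have h1 : Smax q₁ q₂ f + ((√(-t) ^ 2 : ℝ) : ℂ) • (f : L2) = 0 := congrArg Prod.fst hf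
    have h2 : T.mulVecLin (Gamma0 f) - Gamma1 q₁ q₂ f = 0 := congrArg Prod.snd hf
    have hmem : (f : L2) ∈ (H T q₁ q₂).domain := mem_H_domain_iff.mpr ⟨f, rfl, sub_eq_zero.mp h2⟩
    refine htS ⟨⟨f, hmem⟩, fun h => hne (Subtype.ext h), ?_⟩
    rw [H_apply (f := f) rfl, eq_neg_of_add_eq_zero_left h1, hκt, Complex.ofReal_neg, neg_smul,
      neg_neg]
  refine isSelfAdjoint_of_surjective hsym (√(-t) ^ 2) fun h => ?_
  obtain ⟨f, hf⟩ := boundaryProblem_surjective hκ hinj (h, 0)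
  have h1 : Smax q₁ q₂ f + ((√(-t) ^ 2 : ℝ) : ℂ) • (f : L2) = h := congrArg Prod.fst hf
  have h2 : T.mulVecLin (Gamma0 f) - Gamma1 q₁ q₂ f = 0 := congrArg Prod.snd hf
  refine ⟨⟨f, mem_H_domain_iff.mpr ⟨f, rfl, sub_eq_zero.mp h2⟩⟩, ?_⟩
  rw [H_apply (f := f) rfl, h1]

end NonlocalPoint

end

theorem lemma3p1 (a b c d : ℂ) (ha : a.im = 0) (hd : d.im = 0) (hbc : b = star c)
    (q₁ q₂ : NonlocalPoint.L2) :
    IsSelfAdjoint (NonlocalPoint.H !![a, b; c, d] q₁ q₂) := by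
  refine NonlocalPoint.isSelfAdjoint_H (Matrix.IsHermitian.ext fun i j => ?_) q₁ q₂
  fin_cases i <;> fin_cases j
  · exact Complex.conj_eq_iff_im.mpr ha
  · exact hbc.symm
  · exact (congrArg star hbc).trans (star_star c)
  · exact Complex.conj_eq_iff_im.mpr hd
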